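/- Let $M$ be a complete smooth Riemannian manifold (without boundary, second countable, of dimension $d$), with Riemannian distance $d(\cdot,\cdot)$ (equal to $\infty$ between points of different components, if $M$ is not connected) and Riemannian volume measure $\mathcal L$ (given by $\sqrt{\det (g_{ij})}\,dv$ in charts). Let $T:M\to M$ be continuous and let $\mu$ be an ergodic $T$-invariant Borel probability measure on $M$. For $n\ge 1$, $r>0$ and $x\in M$ let $$B_n(x,r)=\{y\in M:\ d(T^ix,T^iy)<r\ \text{ for all } 0\le i\le n-1\}.$$ For a finite measurable partition $\mathcal P$ of $M$, let $\mathcal P^n=\bigvee_{i=0}^{n-1}T^{-i}\mathcal P$ and $H_\mu(\mathcal P^n)=-\sum_{P\in\mathcal P^n}\mu(P)\log\mu(P)$, and let $$h_\mu(T)=\sup_{\mathcal P\text{ finite}}\ \lim_{n\to\infty}\frac1n H_\mu(\mathcal P^n)$$ be the measure-theoretic entropy. Then, in $[-\infty,\infty]$, $$h_\mu(T)\ \le\ \sup_{K}\ \operatorname*{ess\,sup}_{x\in K}\ \lim_{r\to0^+}\ \limsup_{\substack{n\to\infty\\ T^nx\in K}}\ -\frac1n\log\mathcal L(B_n(x,r)),$$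 where the supremum is over all compact sets $K\subset M$ with $\mu(K)>0$, the essential supremum is with respect to $\mu$ restricted to $K$, and $\log 0=-\infty$, $\log\infty=\infty$. -/

import Mathlib

open MeasureTheory Filter Topology Set Bundle
open scoped Manifold ContDiff ENNReal

noncomputable section

/-! ### Measure-theoretic entropy -/

section MeasureEntropy

variable {X : Type*} [MeasurableSpace X]

/-- A finite measurable partition of `X` into `k` cells (empty cells are allowed; they contribute
`0 log 0 = 0` to all entropies). -/
structure FinMeasPartition (X : Type*) [MeasurableSpace X] (k : ℕ) where
  cell : Fin k → Set X
  measurable_cell : ∀ i, MeasurableSet (cell i)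
  disjoint_cell : Pairwise fun i j => Disjoint (cell i) (cell j)
  iUnion_cell : ⋃ i, cell i = univ

/-- The cell of `P ∨ T⁻¹ P ∨ ⋯ ∨ T⁻⁽ⁿ⁻¹⁾ P` with itinerary `a`. -/
def FinMeasPartition.dynCell {k : ℕ} (P : FinMeasPartition X k) (T : X → X) (n : ℕ)
    (a : Fin n → Fin k) : Set X :=
  ⋂ i : Fin n, T^[(i : ℕ)] ⁻¹' P.cell (a i)

/-- `H_μ(Pⁿ) = - ∑ μ(C) log μ(C)`, the sum over the cells `C` of `P ∨ ⋯ ∨ T⁻⁽ⁿ⁻¹⁾ P`. -/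
def FinMeasPartition.dynEntropy {k : ℕ} (P : FinMeasPartition X k) (T : X → X) (μ : Measure X)
    (n : ℕ) : ℝ :=
  ∑ a : Fin n → Fin k, Real.negMulLog (μ.real (P.dynCell T n a))

/-- `h_μ(T, P) = lim (1/n) H_μ(Pⁿ)`. For a `T`-invariant probability measure the sequence
`H_μ(Pⁿ)` is subadditive, so the limit exists and is the upper limit used here. -/
def partitionEntropy {k : ℕ} (T : X → X) (μ : Measure X) (P : FinMeasPartition X k) : EReal :=
  limsup (fun n : ℕ => ((P.dynEntropy T μ n / n : ℝ) : EReal)) atTop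

/-- The measure-theoretic (Kolmogorov-Sinai) entropy `h_μ(T)`. -/
def measureEntropy (T : X → X) (μ : Measure X) : EReal :=
  ⨆ (k : ℕ) (P : FinMeasPartition X k), partitionEntropy T μ P

end MeasureEntropy

/-! ### Riemannian volume -/

section RiemannianVolume

variable {d : ℕ} {M : Type*} [TopologicalSpace M] [ChartedSpace (EuclideanSpace ℝ (Fin d)) M]
  [RiemannianBundle (fun p : M => TangentSpace (𝓡 d) p)]

/-- The `i`-th coordinate vector field `∂ᵢ` of the preferred chart around `x`, at the point with
coordinates `v`. -/
def coordVector (x : M) (v : EuclideanSpace ℝ (Fin d)) (i : Fin d) :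
    TangentSpace (𝓡 d) ((extChartAt (𝓡 d) x).symm v) :=
  mfderiv 𝓘(ℝ, EuclideanSpace ℝ (Fin d)) (𝓡 d) (extChartAt (𝓡 d) x).symm v
    (EuclideanSpace.single i (1 : ℝ) : EuclideanSpace ℝ (Fin d))

/-- The matrix `gᵢⱼ = ⟨∂ᵢ, ∂ⱼ⟩` of the Riemannian metric in the preferred chart around `x`. -/
def metricMatrix (x : M) (v : EuclideanSpace ℝ (Fin d)) : Matrix (Fin d) (Fin d) ℝ :=
  Matrix.of fun i j => inner ℝ (coordVector x v i) (coordVector x v j)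

/-- For a set `A` inside the domain of the preferred chart `φ` around `x`, its Riemannian volume
`∫_{φ(A)} √(det gᵢⱼ(v)) dv` computed in this chart. -/
def chartVolume (d : ℕ) {M : Type*} [TopologicalSpace M]
    [ChartedSpace (EuclideanSpace ℝ (Fin d)) M]
    [RiemannianBundle (fun p : M => TangentSpace (𝓡 d) p)] (x : M) (A : Set M) : ℝ≥0∞ :=
  ∫⁻ v in extChartAt (𝓡 d) x '' A, ENNReal.ofReal (Real.sqrt (metricMatrix x v).det)

/-- The volume of a set that is contained in the domain of a preferred chart (the value does not
depend on the chart, by the change of variables formula), and `∞` for the other sets. -/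
def smallVolume (d : ℕ) {M : Type*} [TopologicalSpace M]
    [ChartedSpace (EuclideanSpace ℝ (Fin d)) M]
    [RiemannianBundle (fun p : M => TangentSpace (𝓡 d) p)] (A : Set M) : ℝ≥0∞ :=
  ⨅ (x : M) (_ : A ⊆ (extChartAt (𝓡 d) x).source), chartVolume d x A

theorem borel_le_caratheodory_smallVolume [MeasurableSpace M] [BorelSpace M] :
    ‹MeasurableSpace M› ≤ (OuterMeasure.boundedBy (smallVolume d (M := M))).caratheodory := by
  intro s hs
  refine OuterMeasure.boundedBy_caratheodory fun t => ?_
  refine le_iInf₂ fun x hx => ?_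
  refine le_trans (add_le_add (iInf₂_le x (inter_subset_left.trans hx))
    (iInf₂_le x (sdiff_subset.trans hx))) ?_
  set φ := extChartAt (𝓡 d) x with hφ
  -- the coordinate image of the Borel set `s`
  have hmeas : MeasurableSet (φ.target ∩ φ.symm ⁻¹' s) := by
    have hc : ContinuousOn φ.symm φ.target := continuousOn_extChartAt_symm x
    have ht : MeasurableSet φ.target := (isOpen_extChartAt_target x).measurableSet
    have h1 : Measurable (φ.target.domRestrict φ.symm) :=
      (continuousOn_iff_continuous_domRestrict.1 hc).measurable
    have h2 := ht.subtype_image (h1 hs)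
    convert h2 using 1
    ext v
    simp [Set.domRestrict, and_comm]
  have e1 : φ '' (t ∩ s) = (φ '' t) ∩ (φ.target ∩ φ.symm ⁻¹' s) := by
    ext v
    constructor
    · rintro ⟨y, ⟨hyt, hys⟩, rfl⟩
      exact ⟨⟨y, hyt, rfl⟩, φ.map_source (hx hyt), by
        simpa [φ.left_inv (hx hyt)] using hys⟩
    · rintro ⟨⟨y, hyt, rfl⟩, -, hys⟩
      refine ⟨y, ⟨hyt, ?_⟩, rfl⟩
      simpa [φ.left_inv (hx hyt)] using hys
  have e2 : φ '' (t \ s) = (φ '' t) \ (φ.target ∩ φ.symm ⁻¹' s) := by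
    ext v
    constructor
    · rintro ⟨y, ⟨hyt, hys⟩, rfl⟩
      refine ⟨⟨y, hyt, rfl⟩, fun h => hys ?_⟩
      simpa [φ.left_inv (hx hyt)] using h.2
    · rintro ⟨⟨y, hyt, rfl⟩, h⟩
      refine ⟨y, ⟨hyt, fun hys => h ⟨φ.map_source (hx hyt), ?_⟩⟩, rfl⟩
      simpa [φ.left_inv (hx hyt)] using hys
  unfold chartVolume
  rw [e1, e2, lintegral_inter_add_sdiff _ _ hmeas]

/-- The Riemannian volume measure: the measure on `M` given by `√(det gᵢⱼ) dv` in charts, that is,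
`L(A)` is the infimum of `∑ₖ ∫_{φₖ(Aₖ)} √(det gᵢⱼ) dv` over the countable coverings of `A` by sets
`Aₖ`, each contained in the domain of a chart `φₖ`. -/
def riemannianVolume (d : ℕ) (M : Type*) [TopologicalSpace M]
    [ChartedSpace (EuclideanSpace ℝ (Fin d)) M]
    [RiemannianBundle (fun p : M => TangentSpace (𝓡 d) p)]
    [MeasurableSpace M] [BorelSpace M] : Measure M :=
  (OuterMeasure.boundedBy (smallVolume d (M := M))).toMeasure borel_le_caratheodory_smallVolume

end RiemannianVolume

/-! ### Local volume decay of dynamical balls -/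

section LocalEntropy

variable {M : Type*} [EMetricSpace M]

/-- The dynamical ball `B_n(x, r)`: the points `y` with `d(Tⁱ x, Tⁱ y) < r` for
`0 ≤ i ≤ n - 1`. -/
def dynBall (T : M → M) (n : ℕ) (x : M) (r : ℝ) : Set M :=
  {y | ∀ i < n, edist (T^[i] x) (T^[i] y) < ENNReal.ofReal r}

/-- The upper limit of `-(1/n) log L(B_n(x, r))` as `n → ∞` along the times `n` with `Tⁿ x ∈ K`. -/
def returnDecayAt [MeasurableSpace M] (T : M → M) (L : Measure M) (K : Set M) (x : M) (r : ℝ) :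
    EReal :=
  limsup (fun n : ℕ => ((-(1 / (n : ℝ)) : ℝ) : EReal) * ENNReal.log (L (dynBall T n x r)))
    (atTop ⊓ 𝓟 {n : ℕ | T^[n] x ∈ K})

theorem returnDecayAt_antitone [MeasurableSpace M] (T : M → M) (L : Measure M) (K : Set M)
    (x : M) : Antitone (returnDecayAt T L K x) := by
  intro r s hrs
  refine limsup_le_limsup (Eventually.of_forall fun n => ?_)
  have h : ENNReal.log (L (dynBall T n x r)) ≤ ENNReal.log (L (dynBall T n x s)) :=
    ENNReal.log_monotone (measure_mono fun y hy i hi =>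
      (hy i hi).trans_le (ENNReal.ofReal_le_ofReal hrs))
  have hc : (0 : EReal) ≤ ((1 / (n : ℝ) : ℝ) : EReal) := by
    exact_mod_cast (by positivity : (0 : ℝ) ≤ 1 / (n : ℝ))
  simp only [EReal.coe_neg, neg_mul]
  exact EReal.neg_le_neg_iff.2 (mul_le_mul_of_nonneg_left h hc)

/-- `lim_{r → 0} limsup_{n → ∞, Tⁿ x ∈ K} -(1/n) log L(B_n(x, r))`. -/
def returnDecay [MeasurableSpace M] (T : M → M) (L : Measure M) (K : Set M) (x : M) : EReal :=
  limUnder (𝓝[>] (0 : ℝ)) (returnDecayAt T L K x)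

/-- The limit in the definition of `returnDecay` exists. -/
theorem tendsto_returnDecay [MeasurableSpace M] (T : M → M) (L : Measure M) (K : Set M) (x : M) :
    Tendsto (returnDecayAt T L K x) (𝓝[>] (0 : ℝ)) (𝓝 (returnDecay T L K x)) :=
  tendsto_nhds_limUnder ⟨_, (returnDecayAt_antitone T L K x).tendsto_nhdsGT 0⟩

/-- The local Riemannian entropy over `K`, with respect to the volume `L`: the `μ`-essential
supremum over `x ∈ K` of `returnDecay`. -/
def localVolumeEntropyOn [MeasurableSpace M] (T : M → M) (μ L : Measure M) (K : Set M) : EReal :=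
  essSup (returnDecay T L K) (μ.restrict K)

/-- The local Riemannian entropy: the supremum over the compact sets of positive `μ`-measure. -/
def localVolumeEntropy [MeasurableSpace M] (T : M → M) (μ L : Measure M) : EReal :=
  ⨆ (K : Set M) (_ : IsCompact K) (_ : 0 < μ K), localVolumeEntropyOn T μ L K

end LocalEntropy

end

/-! Fix a partition. Inner regularity yields compact `Q j` inside its cells, of total mass close to
1. Their union `K` is the compact set tested in the supremum. Distinct `Q j` are at distance at
least `2r`, and the `r`-balls around points of `K` lie in an open `V` of finite volume.

If the local entropy is below `s`, then for most `x` in `K` and all large `n` with `T^n x ∈ K`, the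
volume of `B_n(x, r)` is at least `exp (-ns)`. By invariance, for each `n` most points do return to
`K` at time `n`, and Markov's inequality bounds the time spent outside `K` by `δn`.

Choose one such point per itinerary. If two of the dynamical balls share a point, the two orbits lie
in the same `Q j` whenever both are in `K`, so the itineraries differ in at most `2δn` places. A
Hamming ball of that radius has subexponential size as `δ → 0`, so the balls overlap little.
Comparing with the volume of `V` leaves at most about `exp (ns)` itineraries
(`card_itineraries_mul_le`), which bounds the entropy up to a small multiple of `n`
(`dynEntropy_le_log_card_itineraries`). -/

/-! ### Entropy and counting inequalities -/

/-- Gibbs' inequality term by term, from `log u ≤ u - 1` at `u = q / p`. -/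
theorem negMulLog_le_neg_mul_log_add {p q : ℝ} (hp : 0 ≤ p) (hq : 0 < q) :
    Real.negMulLog p ≤ -(p * Real.log q) + q - p := by
  rcases hp.eq_or_lt with rfl | hp
  · simpa using hq.le
  · have h := Real.log_le_sub_one_of_pos (div_pos hq hp)
    rw [Real.log_div hq.ne' hp.ne'] at h
    have h2 := mul_le_mul_of_nonneg_left h hp.le
    have h3 : p * (q / p - 1) = q - p := by field_simp
    rw [Real.negMulLog]
    linarith

/-- The entropy of a probability vector that gives the mass `∑ i ∈ S, p i` to a set `S`. -/
theorem sum_negMulLog_le_log_card {ι : Type*} [Fintype ι] (S : Finset ι)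
    (hS : S.Nonempty) (p : ι → ℝ) (hp : ∀ i, 0 ≤ p i) (hsum : ∑ i, p i = 1) :
    ∑ i, Real.negMulLog (p i) ≤ Real.log 2 + Real.log S.card +
      (1 - ∑ i ∈ S, p i) * Real.log (Fintype.card ι) := by
  classical
  have hN : 0 < (Fintype.card ι : ℝ) := by
    have := hS.choose
    exact_mod_cast Fintype.card_pos_iff.2 ⟨this⟩
  have hs : 0 < (S.card : ℝ) := by exact_mod_cast hS.card_pos
  set N : ℝ := (Fintype.card ι : ℝ)
  set s : ℝ := (S.card : ℝ)
  -- The comparison weights spread mass 1/2 evenly over `S`, and outside `S` are those of mass 1/2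
  -- spread over all of `ι`. The corrections `1/2 + 1/2 - 1` then cancel.
  have hin : ∑ i ∈ S, Real.negMulLog (p i) ≤
      (∑ i ∈ S, p i) * (Real.log 2 + Real.log s) + 1 / 2 - ∑ i ∈ S, p i := by
    calc ∑ i ∈ S, Real.negMulLog (p i)
        ≤ ∑ i ∈ S, (p i * (Real.log 2 + Real.log s) + 1 / (2 * s) - p i) := by
          refine Finset.sum_le_sum fun i _ => ?_
          have := negMulLog_le_neg_mul_log_add (hp i) (q := 1 / (2 * s)) (by positivity)
          rw [one_div, Real.log_inv, Real.log_mul two_ne_zero hs.ne', ← one_div] at this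
          linarith
      _ = _ := by
          rw [Finset.sum_sub_distrib, Finset.sum_add_distrib, ← Finset.sum_mul, Finset.sum_const,
            nsmul_eq_mul]
          congr 2
          change s * (1 / (2 * s)) = 1 / 2
          field_simp
  have hout : ∑ i ∈ Sᶜ, Real.negMulLog (p i) ≤
      (∑ i ∈ Sᶜ, p i) * (Real.log 2 + Real.log N) + 1 / 2 - ∑ i ∈ Sᶜ, p i := by
    calc ∑ i ∈ Sᶜ, Real.negMulLog (p i)
        ≤ ∑ i ∈ Sᶜ, (p i * (Real.log 2 + Real.log N) + 1 / (2 * N) - p i) := by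
          refine Finset.sum_le_sum fun i _ => ?_
          have := negMulLog_le_neg_mul_log_add (hp i) (q := 1 / (2 * N)) (by positivity)
          rw [one_div, Real.log_inv, Real.log_mul two_ne_zero hN.ne', ← one_div] at this
          linarith
      _ ≤ _ := by
          rw [Finset.sum_sub_distrib, Finset.sum_add_distrib, ← Finset.sum_mul, Finset.sum_const,
            nsmul_eq_mul]
          gcongr
          have : ((Sᶜ).card : ℝ) ≤ N := Nat.cast_le.2 (Finset.card_le_univ _)
          rw [mul_one_div, div_le_div_iff₀ (by positivity) (by positivity)]
          linarith
  have hc : ∑ i ∈ Sᶜ, p i = 1 - ∑ i ∈ S, p i := by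
    rw [← hsum, ← Finset.sum_add_sum_compl S p]; ring
  have hle : ∑ i ∈ S, p i ≤ 1 := by
    have := Finset.sum_nonneg (s := Sᶜ) fun i _ => hp i
    linarith
  have hlog : (∑ i ∈ S, p i) * Real.log s ≤ Real.log s :=
    mul_le_of_le_one_left (Real.log_nonneg (Nat.one_le_cast.2 hS.card_pos)) hle
  rw [hc] at hout
  rw [← Finset.sum_add_sum_compl S]
  linarith

/-- An exponential bound for the cardinality of a ball in the Hamming distance. -/
theorem card_hammingBall_le {n k : ℕ} (b : Fin n → Fin k) (m t : ℝ) (ht : 0 ≤ t)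
    (S : Finset (Fin n → Fin k)) (hS : ∀ a ∈ S, (hammingDist a b : ℝ) ≤ m) :
    (S.card : ℝ) ≤ Real.exp (t * m + n * (k * Real.exp (-t))) := by
  classical
  -- Chernoff's method: the product weight is `exp (-t * hammingDist a b)`. Its total factorises
  -- over the coordinates, and each element of `S` contributes at least `exp (-t * m)`.
  set w : Fin n → Fin k → ℝ := fun i c => if c = b i then 1 else Real.exp (-t)
  have hw : ∀ i c, 0 ≤ w i c := fun i c => by
    simp only [w]; split_ifs <;> positivity
  have hprod : ∀ a, ∏ i, w i (a i) = Real.exp (-t * hammingDist a b) := fun a => by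
    simp only [w, Finset.prod_ite, Finset.prod_const_one, one_mul, Finset.prod_const,
      hammingDist, ← Real.exp_nat_mul]
    congr 1
    ring
  have htot : ∑ a : Fin n → Fin k, ∏ i, w i (a i) ≤ Real.exp (n * (k * Real.exp (-t))) := by
    have : ∑ a : Fin n → Fin k, ∏ i, w i (a i) = ∏ i, ∑ c, w i c := by
      rw [Finset.prod_univ_sum, Fintype.piFinset_univ]
    rw [this]
    calc ∏ i, ∑ c, w i c ≤ ∏ _i : Fin n, Real.exp (k * Real.exp (-t)) := by
          refine Finset.prod_le_prod (fun i _ => Finset.sum_nonneg fun c _ => hw i c) fun i _ => ?_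
          calc ∑ c, w i c ≤ ∑ c, ((if c = b i then 1 else 0) + Real.exp (-t)) := by
                refine Finset.sum_le_sum fun c _ => ?_
                simp only [w]
                split_ifs
                · linarith [Real.exp_pos (-t)]
                · simp
            _ = k * Real.exp (-t) + 1 := by
                simp [Finset.sum_add_distrib, add_comm]
            _ ≤ _ := Real.add_one_le_exp _
      _ = _ := by rw [Finset.prod_const, ← Real.exp_nat_mul]; simp
  have hlow : (S.card : ℝ) * Real.exp (-t * m) ≤ ∑ a : Fin n → Fin k, ∏ i, w i (a i) := by
    calc (S.card : ℝ) * Real.exp (-t * m) = ∑ _a ∈ S, Real.exp (-t * m) := by simp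
      _ ≤ ∑ a ∈ S, ∏ i, w i (a i) := by
          refine Finset.sum_le_sum fun a ha => ?_
          rw [hprod]
          have := mul_le_mul_of_nonneg_left (hS a ha) ht
          exact Real.exp_le_exp.2 (by linarith)
      _ ≤ _ := Finset.sum_le_univ_sum_of_nonneg fun a => Finset.prod_nonneg fun i _ => hw i _
  have := hlow.trans htot
  rw [Real.exp_add]
  have he : Real.exp (t * m) * Real.exp (-t * m) = 1 := by
    rw [← Real.exp_add]; simp
  calc (S.card : ℝ) = Real.exp (t * m) * (S.card * Real.exp (-t * m)) := by
        rw [mul_left_comm, he, mul_one]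
    _ ≤ _ := by gcongr

/-- If the sets `B a` have measure at least `c`, lie in `U`, and no point is in more than `m` of
them, then there are at most `m * μ U / c` of them. -/
theorem card_mul_le_of_multiplicity_le {X ι : Type*} [MeasurableSpace X] (μ : Measure X)
    (I : Finset ι) (B : ι → Set X) (hB : ∀ a ∈ I, MeasurableSet (B a)) (U : Set X)
    (hU : MeasurableSet U) (hBU : ∀ a ∈ I, B a ⊆ U) (c m : ℝ≥0∞) (hc : ∀ a ∈ I, c ≤ μ (B a))
    (hm : ∀ y, ∀ J ⊆ I, (∀ a ∈ J, y ∈ B a) → (J.card : ℝ≥0∞) ≤ m) :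
    I.card * c ≤ m * μ U := by
  classical
  -- Integrate the overlap count, which is at most `m` on `U` and zero elsewhere.
  calc (I.card : ℝ≥0∞) * c = ∑ _a ∈ I, c := by simp
    _ ≤ ∑ a ∈ I, μ (B a) := Finset.sum_le_sum hc
    _ = ∑ a ∈ I, ∫⁻ y, (B a).indicator 1 y ∂μ :=
        Finset.sum_congr rfl fun a ha => (lintegral_indicator_one (hB a ha)).symm
    _ = ∫⁻ y, ∑ a ∈ I, (B a).indicator 1 y ∂μ :=
        (lintegral_finsetSum' _ fun a ha =>
          (measurable_one.indicator (hB a ha)).aemeasurable).symm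
    _ ≤ ∫⁻ y, U.indicator (fun _ => m) y ∂μ := by
        refine lintegral_mono fun y => ?_
        by_cases hy : y ∈ U
        · rw [indicator_of_mem hy]
          have := hm y (I.filter fun a => y ∈ B a) (Finset.filter_subset _ _)
            fun a ha => (Finset.mem_filter.1 ha).2
          simpa [indicator_apply, Finset.sum_ite] using this
        · rw [indicator_of_notMem hy]
          refine (Finset.sum_eq_zero fun a ha => ?_).le
          exact indicator_of_notMem (fun h => hy (hBU a ha h)) _
    _ = m * μ U := lintegral_indicator_const hU m

open Classical in
/-- Markov's inequality for the number of visits to `U` up to time `n`. -/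
theorem measure_visits_gt_le {X : Type*} [MeasurableSpace X] {T : X → X} {μ : Measure X}
    (hT : MeasurePreserving T μ μ) {U : Set X} (hU : MeasurableSet U) (n : ℕ) (hn : 0 < n)
    {δ : ℝ} (hδ : 0 < δ) :
    μ {x | δ * n < ((Finset.univ.filter fun i : Fin n => T^[(i : ℕ)] x ∈ U).card : ℝ)} ≤
      μ U / ENNReal.ofReal δ := by
  set f : X → ℝ≥0∞ := fun x => ∑ i : Fin n, (T^[(i : ℕ)] ⁻¹' U).indicator 1 x
  have hmeas : ∀ i : Fin n, MeasurableSet (T^[(i : ℕ)] ⁻¹' U) := fun i =>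
    (hT.iterate i).measurable hU
  have hfm : Measurable f := Finset.measurable_sum _ fun i _ =>
    measurable_one.indicator (hmeas i)
  have hf : ∫⁻ x, f x ∂μ = n * μ U := by
    simp only [f]
    rw [lintegral_finsetSum _ fun i _ => measurable_one.indicator (hmeas i)]
    simp [lintegral_indicator_one (hmeas _), (hT.iterate _).measure_preimage hU.nullMeasurableSet]
  have hcard : ∀ x, f x = (Finset.univ.filter fun i : Fin n => T^[(i : ℕ)] x ∈ U).card := by
    intro x
    simp [f, indicator_apply]
  have h := mul_meas_ge_le_lintegral (μ := μ) hfm (ENNReal.ofReal (δ * n))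
  have hn' : (0 : ℝ) < n := by exact_mod_cast hn
  have hpos : ENNReal.ofReal (δ * n) ≠ 0 := by
    simpa using (by positivity : 0 < δ * n)
  rw [hf] at h
  have hsub : {x | δ * n < ((Finset.univ.filter fun i : Fin n => T^[(i : ℕ)] x ∈ U).card : ℝ)} ⊆
      {x | ENNReal.ofReal (δ * n) ≤ f x} := by
    intro x hx
    rw [mem_ofPred_eq, hcard]
    exact ENNReal.ofReal_le_of_le_toReal (by simpa using (le_of_lt hx))
  refine (measure_mono hsub).trans ?_
  rw [ENNReal.le_div_iff_mul_le (by simp [hδ]) (by simp)]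
  rw [mul_comm]
  refine (ENNReal.mul_le_mul_iff_right (Nat.cast_ne_zero.2 hn.ne') (ENNReal.natCast_ne_top n)).1 ?_
  rw [← mul_assoc, mul_comm (n : ℝ≥0∞) (ENNReal.ofReal δ), ← ENNReal.ofReal_natCast (n := n),
    ← ENNReal.ofReal_mul hδ.le, ENNReal.ofReal_natCast]
  exact h

/-! ### Local finiteness of the Riemannian volume -/

section
attribute [local instance] normedAddCommGroupTangentSpaceVectorSpace
attribute [local instance] normedSpaceTangentSpaceVectorSpace

theorem eventually_norm_coordVector_le {d : ℕ} {M : Type*} [PseudoEMetricSpace M]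
    [ChartedSpace (EuclideanSpace ℝ (Fin d)) M] [IsManifold (𝓡 d) 1 M]
    [RiemannianBundle (fun p : M => TangentSpace (𝓡 d) p)]
    [IsContinuousRiemannianBundle (EuclideanSpace ℝ (Fin d)) (fun p : M => TangentSpace (𝓡 d) p)]
    (x : M) : ∃ C, ∀ᶠ v in 𝓝 (extChartAt (𝓡 d) x x), ∀ i, ‖coordVector x v i‖ ≤ C := by
  obtain ⟨C, hC0, hC⟩ := eventually_norm_mfderivWithin_symm_extChartAt_lt (𝓡 d) x
  have hr : range (𝓡 d) = univ := ModelWithCorners.Boundaryless.range_eq_univ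
  rw [hr, nhdsWithin_univ] at hC
  refine ⟨C, ?_⟩
  filter_upwards [hC] with v hv i
  rw [mfderivWithin_univ] at hv
  refine (ContinuousLinearMap.le_opNorm (mfderiv 𝓘(ℝ, EuclideanSpace ℝ (Fin d)) (𝓡 d)
    (extChartAt (𝓡 d) x).symm v) _).trans ?_
  have h1 : ‖(EuclideanSpace.single i (1 : ℝ) : EuclideanSpace ℝ (Fin d))‖ = 1 := by simp
  refine (mul_le_mul_of_nonneg_left (le_of_eq h1) (norm_nonneg _)).trans ?_
  rw [mul_one]
  exact hv.le
end

/-- The Riemannian volume is finite near every point. -/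
theorem exists_mem_nhds_riemannianVolume_lt_top {d : ℕ} {M : Type*} [PseudoEMetricSpace M]
    [ChartedSpace (EuclideanSpace ℝ (Fin d)) M] [IsManifold (𝓡 d) 1 M]
    [RiemannianBundle (fun p : M => TangentSpace (𝓡 d) p)]
    [IsContinuousRiemannianBundle (EuclideanSpace ℝ (Fin d)) (fun p : M => TangentSpace (𝓡 d) p)]
    [MeasurableSpace M] [BorelSpace M] (x : M) :
    ∃ U ∈ 𝓝 x, riemannianVolume d M U < ⊤ := by
  obtain ⟨C, hC⟩ := eventually_norm_coordVector_le (d := d) x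
  have hdet : ∀ᶠ v in 𝓝 (extChartAt (𝓡 d) x x),
      (metricMatrix x v).det ≤ d.factorial * (C * C) ^ d := by
    filter_upwards [hC] with v hv
    -- Cauchy–Schwarz bounds the entries, and the Leibniz expansion the determinant.
    have h := Matrix.det_le (A := metricMatrix x v) (abv := AbsoluteValue.abs) (x := C * C)
      fun i j => (abs_real_inner_le_norm _ _).trans
        (mul_le_mul (hv i) (hv j) (norm_nonneg _) ((norm_nonneg _).trans (hv i)))
    simpa using (le_abs_self _).trans h
  obtain ⟨ε, hε, hball⟩ := Metric.mem_nhds_iff.1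
    (inter_mem hdet (extChartAt_target_mem_nhds (I := 𝓡 d) x))
  set φ := extChartAt (𝓡 d) x with hφ
  set U : Set M := φ.source ∩ φ ⁻¹' Metric.ball (φ x) ε with hU
  refine ⟨U, inter_mem (extChartAt_source_mem_nhds x)
    ((continuousAt_extChartAt x).preimage_mem_nhds (Metric.ball_mem_nhds _ hε)), ?_⟩
  have himg : φ '' U ⊆ Metric.ball (φ x) ε := by
    rintro _ ⟨y, hy, rfl⟩
    exact hy.2
  have hUo : IsOpen U := (continuousOn_extChartAt x).isOpen_inter_preimage
    (isOpen_extChartAt_source x) Metric.isOpen_ball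
  -- An upper bound in one chart suffices, so charts need not be compared.
  have hmeas : riemannianVolume d M U ≤ chartVolume d x U := by
    rw [riemannianVolume, toMeasure_apply _ _ hUo.measurableSet]
    exact (OuterMeasure.boundedBy_le U).trans (iInf₂_le x inter_subset_left)
  refine hmeas.trans_lt ?_
  calc chartVolume d x U
      ≤ ∫⁻ v in Metric.ball (φ x) ε, ENNReal.ofReal (Real.sqrt (metricMatrix x v).det) :=
        lintegral_mono_set himg
    _ ≤ ∫⁻ _v in Metric.ball (φ x) ε,
          ENNReal.ofReal (Real.sqrt (d.factorial * (C * C) ^ d)) :=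
        setLIntegral_mono' Metric.isOpen_ball.measurableSet fun v hv =>
          ENNReal.ofReal_le_ofReal (Real.sqrt_le_sqrt (hball hv).1)
    _ < ⊤ := by
        rw [setLIntegral_const]
        exact ENNReal.mul_lt_top ENNReal.ofReal_lt_top measure_ball_lt_top

theorem isLocallyFiniteMeasure_riemannianVolume {d : ℕ} {M : Type*} [PseudoEMetricSpace M]
    [ChartedSpace (EuclideanSpace ℝ (Fin d)) M] [IsManifold (𝓡 d) 1 M]
    [RiemannianBundle (fun p : M => TangentSpace (𝓡 d) p)]
    [IsContinuousRiemannianBundle (EuclideanSpace ℝ (Fin d)) (fun p : M => TangentSpace (𝓡 d) p)]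
    [MeasurableSpace M] [BorelSpace M] : IsLocallyFiniteMeasure (riemannianVolume d M) :=
  ⟨exists_mem_nhds_riemannianVolume_lt_top⟩

/-! ### Volume of dynamical balls -/

theorem isOpen_dynBall {M : Type*} [EMetricSpace M] {T : M → M} (hT : Continuous T) (n : ℕ)
    (x : M) (r : ℝ) : IsOpen (dynBall T n x r) := by
  have : dynBall T n x r =
      ⋂ i ∈ Finset.range n, {y | edist (T^[i] x) (T^[i] y) < ENNReal.ofReal r} := by
    ext y; simp [dynBall]
  rw [this]
  exact isOpen_biInter_finset fun i _ =>
    isOpen_lt (continuous_const.edist (hT.iterate i)) continuous_const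

theorem ofReal_exp_le_of_neg_div_mul_log_lt {n : ℕ} (hn : 0 < n) {s : ℝ} {v : ℝ≥0∞}
    (h : ((-(1 / (n : ℝ)) : ℝ) : EReal) * ENNReal.log v < s) :
    ENNReal.ofReal (Real.exp (-(n * s))) ≤ v := by
  have hn' : (0 : ℝ) < n := Nat.cast_pos.2 hn
  rcases eq_or_ne v ⊤ with rfl | hv
  · exact le_top
  have hneg : -(1 / (n : ℝ)) < 0 := by simpa using hn'
  rcases eq_or_ne v 0 with rfl | hv0
  · rw [ENNReal.log_zero, EReal.coe_mul_bot_of_neg hneg] at h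
    exact absurd h not_top_lt
  rw [ENNReal.log_pos_real hv0 hv, ← EReal.coe_mul, EReal.coe_lt_coe_iff] at h
  have hpos : 0 < v.toReal := ENNReal.toReal_pos hv0 hv
  refine ENNReal.ofReal_le_of_le_toReal ?_
  rw [← Real.le_log_iff_exp_le hpos]
  have h2 := mul_lt_mul_of_pos_left h hn'
  have h3 : (n : ℝ) * (-(1 / (n : ℝ)) * Real.log v.toReal) = - Real.log v.toReal := by
    field_simp
  linarith

/-- The decay rate increases as the radius shrinks, so a bound on its limit holds at every fixed
scale. -/
theorem eventually_le_measure_dynBall {M : Type*} [EMetricSpace M] [MeasurableSpace M] {T : M → M}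
    {L : Measure M} {K : Set M} {x : M} {s : ℝ} (h : returnDecay T L K x < s) {r : ℝ}
    (hr : 0 < r) :
    ∀ᶠ n : ℕ in atTop, T^[n] x ∈ K →
      ENNReal.ofReal (Real.exp (-(n * s))) ≤ L (dynBall T n x r) := by
  have hle : returnDecayAt T L K x r ≤ returnDecay T L K x := by
    refine ge_of_tendsto (tendsto_returnDecay T L K x) ?_
    filter_upwards [Ioo_mem_nhdsGT hr] with r' hr'
    exact returnDecayAt_antitone T L K x hr'.2.le
  have hev := eventually_lt_of_limsup_lt (hle.trans_lt h)
  rw [eventually_inf_principal] at hev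
  filter_upwards [hev, eventually_gt_atTop 0] with n hn hn0 hx
  exact ofReal_exp_le_of_neg_div_mul_log_lt hn0 (hn hx)

/-! ### Itineraries and separated compact sets -/

theorem measurableSet_dynCell {X : Type*} [MeasurableSpace X] {k : ℕ} (P : FinMeasPartition X k)
    {T : X → X} (hT : Measurable T) (n : ℕ) (a : Fin n → Fin k) :
    MeasurableSet (P.dynCell T n a) :=
  MeasurableSet.iInter fun i => hT.iterate i (P.measurable_cell (a i))

theorem pairwise_disjoint_dynCell {X : Type*} [MeasurableSpace X] {k : ℕ}
    (P : FinMeasPartition X k) (T : X → X) (n : ℕ) : Pairwise (Function.onFun Disjoint (P.dynCell T n)) := by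
  intro a b hab
  obtain ⟨i, hi⟩ := Function.ne_iff.1 hab
  rw [Function.onFun, disjoint_left]
  intro x hxa hxb
  exact disjoint_left.1 (P.disjoint_cell hi) (mem_iInter.1 hxa i) (mem_iInter.1 hxb i)

theorem iUnion_dynCell {X : Type*} [MeasurableSpace X] {k : ℕ} (P : FinMeasPartition X k)
    (T : X → X) (n : ℕ) : ⋃ a, P.dynCell T n a = univ := by
  refine eq_univ_of_forall fun x => ?_
  have h : ∀ y, ∃ j, y ∈ P.cell j := fun y => mem_iUnion.1 (P.iUnion_cell ▸ mem_univ y)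
  choose j hj using h
  exact mem_iUnion.2 ⟨fun i => j (T^[(i : ℕ)] x), mem_iInter.2 fun i => hj _⟩

theorem sum_measureReal_dynCell {X : Type*} [MeasurableSpace X] {k : ℕ} (P : FinMeasPartition X k)
    {T : X → X} (hT : Measurable T) (μ : Measure X) [IsProbabilityMeasure μ] (n : ℕ) :
    ∑ a, μ.real (P.dynCell T n a) = 1 := by
  rw [← measureReal_iUnion_fintype (pairwise_disjoint_dynCell P T n)
    (measurableSet_dynCell P hT n), iUnion_dynCell]
  simp

open Classical in
/-- The number of itineraries of the points of a set `A`, if the dynamical balls around the points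
of `A` have volume at least `c` and the orbits of these points are mostly in a union `⋃ j, Q j`
of separated sets, each in one cell of the partition. -/
theorem card_itineraries_mul_le {M : Type*} [EMetricSpace M] [MeasurableSpace M] [BorelSpace M]
    {T : M → M} (hT : Continuous T) (L : Measure M) {k : ℕ} (P : FinMeasPartition M k)
    (Q : Fin k → Set M) (hQP : ∀ j, Q j ⊆ P.cell j) {r : ℝ}
    (hQ : ∀ i j, i ≠ j → ∀ x ∈ Q i, ∀ y ∈ Q j, ENNReal.ofReal r + ENNReal.ofReal r ≤ edist x y)
    {n : ℕ} {δ t : ℝ} (ht : 0 ≤ t) {c : ℝ≥0∞} {A V : Set M} (hV : MeasurableSet V)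
    (hAc : ∀ x ∈ A, c ≤ L (dynBall T n x r)) (hAV : ∀ x ∈ A, dynBall T n x r ⊆ V)
    (hAQ : ∀ x ∈ A,
      ((Finset.univ.filter fun i : Fin n => T^[(i : ℕ)] x ∈ (⋃ j, Q j)ᶜ).card : ℝ) ≤ δ * n) :
    ((Finset.univ.filter fun a => (A ∩ P.dynCell T n a).Nonempty).card : ℝ≥0∞) * c ≤
      ENNReal.ofReal (Real.exp (n * (2 * t * δ + k * Real.exp (-t)))) * L V := by
  set I := Finset.univ.filter fun a => (A ∩ P.dynCell T n a).Nonempty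
  have hI : ∀ a ∈ I, ∃ x ∈ A, x ∈ P.dynCell T n a := fun a ha => (Finset.mem_filter.1 ha).2
  rcases I.eq_empty_or_nonempty with hIe | ⟨a₀, ha₀⟩
  · simp [hIe]
  have : Nonempty M := ⟨(hI a₀ ha₀).choose⟩
  choose! z hzA hza using hI
  refine card_mul_le_of_multiplicity_le L I (fun a => dynBall T n (z a) r)
    (fun a _ => (isOpen_dynBall hT n _ r).measurableSet) V hV (fun a ha => hAV _ (hzA a ha)) c _
    (fun a ha => hAc _ (hzA a ha)) fun y J hJ hy => ?_
  rcases J.eq_empty_or_nonempty with rfl | ⟨b, hb⟩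
  · simp
  have hmem : ∀ a ∈ J, ∀ i : Fin n, ∀ j, T^[(i : ℕ)] (z a) ∈ Q j → j = a i := by
    intro a ha i j hj
    by_contra hne
    exact disjoint_left.1 (P.disjoint_cell hne) (hQP j hj) (mem_iInter.1 (hza a (hJ ha)) i)
  have hdist : ∀ a ∈ J, (hammingDist a b : ℝ) ≤ 2 * δ * n := by
    intro a ha
    have hsub : (Finset.univ.filter fun i => a i ≠ b i) ⊆
        (Finset.univ.filter fun i : Fin n => T^[(i : ℕ)] (z a) ∈ (⋃ j, Q j)ᶜ) ∪
        (Finset.univ.filter fun i : Fin n => T^[(i : ℕ)] (z b) ∈ (⋃ j, Q j)ᶜ) := by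
      intro i hi
      by_contra hcon
      simp only [Finset.mem_union, Finset.mem_filter, Finset.mem_univ, true_and, mem_compl_iff,
        not_or, not_not, mem_iUnion] at hcon
      obtain ⟨⟨j, hj⟩, l, hl⟩ := hcon
      have hjl : j ≠ l := by
        rw [hmem a ha i j hj, hmem b hb i l hl]
        exact (Finset.mem_filter.1 hi).2
      -- Both orbits are within `r` of that of `y` at time `i`, against the `2r` separation.
      refine absurd (hQ j l hjl _ hj _ hl) (not_le.2 ?_)
      refine (edist_triangle_right _ _ (T^[(i : ℕ)] y)).trans_lt ?_
      exact ENNReal.add_lt_add (hy a ha i i.2) (hy b hb i i.2)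
    have h1 := (Finset.card_le_card hsub).trans (Finset.card_union_le _ _)
    have h2 := hAQ _ (hzA a (hJ ha))
    have h3 := hAQ _ (hzA b (hJ hb))
    have h4 : (hammingDist a b : ℝ) ≤ _ := Nat.cast_le.2 h1
    push_cast at h4
    linarith
  -- All itineraries whose balls contain `y` lie in a Hamming ball around one of them.
  have h := card_hammingBall_le b _ t ht J hdist
  rw [← ENNReal.ofReal_natCast]
  refine ENNReal.ofReal_le_ofReal (h.trans (le_of_eq ?_))
  congr 1
  ring

/-- Compact sets in the cells of a partition that carry most of the measure, uniformly separated
and with a neighbourhood of finite volume. -/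
theorem exists_separated_compact_subsets {M : Type*} [EMetricSpace M] [MeasurableSpace M]
    [BorelSpace M] (μ L : Measure M) [IsFiniteMeasure μ] [μ.InnerRegular]
    [IsLocallyFiniteMeasure L] {k : ℕ} (P : FinMeasPartition M k) {ε : ℝ≥0∞} (hε : ε ≠ 0) :
    ∃ (Q : Fin k → Set M) (r : ℝ) (V : Set M), 0 < r ∧ IsCompact (⋃ j, Q j) ∧
      (∀ j, Q j ⊆ P.cell j) ∧ μ (⋃ j, Q j)ᶜ ≤ ε ∧
      (∀ i j, i ≠ j → ∀ x ∈ Q i, ∀ y ∈ Q j, ENNReal.ofReal r + ENNReal.ofReal r ≤ edist x y) ∧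
      IsOpen V ∧ L V < ⊤ ∧ ∀ x ∈ ⋃ j, Q j, Metric.eball x (ENNReal.ofReal r) ⊆ V := by
  have hε' : ε / k ≠ 0 := ENNReal.div_ne_zero.2 ⟨hε, ENNReal.natCast_ne_top k⟩
  choose Q hQP hQc hQμ using fun j =>
    (P.measurable_cell j).exists_isCompact_sdiff_lt (measure_ne_top μ _) hε'
  have hK : IsCompact (⋃ j, Q j) := isCompact_iUnion hQc
  obtain ⟨V, hKV, hVo, hVL⟩ := hK.exists_open_superset_measure_lt_top L
  obtain ⟨r₀, hr₀, hrV⟩ := hK.exists_thickening_subset_open hVo hKV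
  have hsep : ∀ i j, ∃ ρ : ℝ, 0 < ρ ∧
      (i ≠ j → ∀ x ∈ Q i, ∀ y ∈ Q j, ENNReal.ofReal ρ ≤ edist x y) := by
    intro i j
    by_cases hij : i = j
    · exact ⟨1, one_pos, fun h => absurd hij h⟩
    · obtain ⟨ρ, hρ, h⟩ := Metric.exists_pos_forall_lt_edist (hQc i) (hQc j).isClosed
        ((P.disjoint_cell hij).mono (hQP i) (hQP j))
      exact ⟨ρ, hρ, fun _ x hx y hy => by simpa using (h x hx y hy).le⟩
  choose ρ hρ hsep using hsep
  obtain ⟨ρ₀, hρ₀, hmin⟩ : ∃ ρ₀ : ℝ, 0 < ρ₀ ∧ ∀ i j, ρ₀ ≤ ρ i j := by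
    -- A positive lower bound for finitely many numbers, valid also when `k = 0`.
    have h : ∀ᶠ s in 𝓝[>] (0 : ℝ), ∀ i j, s ≤ ρ i j :=
      eventually_all.2 fun i => eventually_all.2 fun j =>
        mem_of_superset (Ioo_mem_nhdsGT (hρ i j)) fun s hs => hs.2.le
    exact (h.and self_mem_nhdsWithin).exists.imp fun s hs => ⟨hs.2, hs.1⟩
  refine ⟨Q, min r₀ (ρ₀ / 2), V, lt_min hr₀ (half_pos hρ₀), hK, hQP, ?_, ?_, hVo, hVL, ?_⟩
  · have hsub : (⋃ j, Q j)ᶜ ⊆ ⋃ j, P.cell j \ Q j := by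
      intro x hx
      obtain ⟨j, hj⟩ := mem_iUnion.1 (P.iUnion_cell ▸ mem_univ x)
      exact mem_iUnion.2 ⟨j, hj, fun h => hx (mem_iUnion.2 ⟨j, h⟩)⟩
    calc μ (⋃ j, Q j)ᶜ ≤ ∑ j, μ (P.cell j \ Q j) :=
          (measure_mono hsub).trans (measure_iUnion_fintype_le _ _)
      _ ≤ ∑ _j : Fin k, ε / k := Finset.sum_le_sum fun j _ => (hQμ j).le
      _ ≤ ε := by
          rw [Finset.sum_const, Finset.card_univ, Fintype.card_fin, nsmul_eq_mul]
          exact ENNReal.mul_div_le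
  · intro i j hij x hx y hy
    refine le_trans ?_ (hsep i j hij x hx y hy)
    rw [← ENNReal.ofReal_add (lt_min hr₀ (half_pos hρ₀)).le (lt_min hr₀ (half_pos hρ₀)).le]
    refine ENNReal.ofReal_le_ofReal (le_trans ?_ (hmin i j))
    linarith [min_le_right r₀ (ρ₀ / 2)]
  · intro x hx y hy
    refine hrV ((Metric.mem_thickening_iff_exists_edist_lt _ _).2 ⟨x, hx, ?_⟩)
    exact (Metric.mem_eball.1 hy).trans_le (ENNReal.ofReal_le_ofReal (min_le_left _ _))

open Classical in
/-- The entropy of `Pⁿ` is controlled by the number of itineraries of a set of almost full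
measure. -/
theorem dynEntropy_le_log_card_itineraries {X : Type*} [MeasurableSpace X] {k : ℕ}
    (P : FinMeasPartition X k) {T : X → X} (hT : Measurable T) (μ : Measure X)
    [IsProbabilityMeasure μ] (n : ℕ) {A : Set X} {θ : ℝ} (hθ : θ < 1)
    (hA : ENNReal.ofReal (1 - θ) ≤ μ A) :
    (Finset.univ.filter fun a => (A ∩ P.dynCell T n a).Nonempty).Nonempty ∧
      P.dynEntropy T μ n ≤ Real.log 2 +
        Real.log (Finset.univ.filter fun a => (A ∩ P.dynCell T n a).Nonempty).card +
        n * (θ * Real.log k) := by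
  set I := Finset.univ.filter fun a => (A ∩ P.dynCell T n a).Nonempty
  have hcover : A ⊆ ⋃ a ∈ I, P.dynCell T n a := by
    intro x hx
    obtain ⟨a, ha⟩ := mem_iUnion.1 (iUnion_dynCell P T n ▸ mem_univ x)
    exact mem_iUnion₂.2 ⟨a, Finset.mem_filter.2 ⟨Finset.mem_univ _, x, hx, ha⟩, ha⟩
  have hmass : 1 - θ ≤ ∑ a ∈ I, μ.real (P.dynCell T n a) := by
    rw [← measureReal_biUnion_finset ((pairwise_disjoint_dynCell P T n).set_pairwise _)
      fun a _ => measurableSet_dynCell P hT n a]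
    exact (ENNReal.ofReal_le_iff_le_toReal (measure_ne_top μ _)).1
      (hA.trans (measure_mono hcover))
  have hne : I.Nonempty := by
    rw [Finset.nonempty_iff_ne_empty]
    intro h
    rw [h, Finset.sum_empty] at hmass
    linarith
  refine ⟨hne, ?_⟩
  have h := sum_negMulLog_le_log_card I hne (fun a => μ.real (P.dynCell T n a))
    (fun _ => measureReal_nonneg) (sum_measureReal_dynCell P hT μ n)
  refine h.trans ?_
  -- The mass outside `A` can spread over at most `k ^ n` itineraries.
  have hcard : Real.log (Fintype.card (Fin n → Fin k)) = n * Real.log k := by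
    simp [Real.log_pow]
  rw [hcard]
  have hk : 0 ≤ n * Real.log k := mul_nonneg n.cast_nonneg (Real.log_natCast_nonneg k)
  have := mul_le_mul_of_nonneg_right
    (show 1 - ∑ a ∈ I, μ.real (P.dynCell T n a) ≤ θ by linarith) hk
  linarith

/-! ### Assembling the estimate -/

/-- `4 * ε` is the mass discarded, `t` the Chernoff exponent and `δ` the allowed frequency outside
`K`. Since `δ` must beat `t`, it is chosen after it. -/
theorem exists_entropy_parameters (k : ℕ) {η : ℝ} (hη : 0 < η) :
    ∃ ε t δ : ℝ, 0 < ε ∧ 4 * ε < 1 ∧ 4 * ε * Real.log k ≤ η ∧ 0 ≤ t ∧ k * Real.exp (-t) ≤ η ∧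
      0 < δ ∧ δ ≤ 1 ∧ 2 * t * δ ≤ η := by
  have hlog := Real.log_natCast_nonneg k
  have hk : (0 : ℝ) ≤ k := k.cast_nonneg
  set l := Real.log k
  set t := Real.log (k / η + 1)
  have ht : 0 ≤ t := Real.log_nonneg (le_add_of_nonneg_left (by positivity))
  refine ⟨min (1 / 8) (η / (4 * (l + 1))), t, min 1 (η / (2 * t + 1)), by positivity, ?_, ?_, ht,
    ?_, by positivity, min_le_left _ _, ?_⟩
  · linarith [min_le_left (1 / 8) (η / (4 * (l + 1)))]
  · calc 4 * min (1 / 8) (η / (4 * (l + 1))) * l ≤ 4 * (η / (4 * (l + 1))) * l := by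
          gcongr; exact min_le_right _ _
      _ = η * (l / (l + 1)) := by field_simp
      _ ≤ η * 1 := by gcongr; exact (div_le_one (by positivity)).2 (by linarith)
      _ = η := mul_one η
  · rw [Real.exp_neg, Real.exp_log (by positivity), ← div_eq_mul_inv,
      div_le_iff₀ (by positivity)]
    have : η * (k / η + 1) = k + η := by field_simp
    linarith
  · calc 2 * t * min 1 (η / (2 * t + 1)) ≤ 2 * t * (η / (2 * t + 1)) := by
          gcongr; exact min_le_right _ _
      _ = η * (2 * t / (2 * t + 1)) := by ring
      _ ≤ η * 1 := by gcongr; exact (div_le_one (by positivity)).2 (by linarith)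
      _ = η := mul_one η

/-- Uniform volume decay on a subset of `K` of almost full measure. -/
theorem exists_uniform_le_measure_dynBall {M : Type*} [EMetricSpace M] [MeasurableSpace M]
    [BorelSpace M] {T : M → M} {μ L : Measure M} {K : Set M} (hK : IsCompact K) {s : ℝ}
    (hs : localVolumeEntropyOn T μ L K < s) {r : ℝ} (hr : 0 < r) {m : ℝ≥0∞} (hm : m < μ K) :
    ∃ N : ℕ, m < μ {x ∈ K | ∀ n ≥ N, T^[n] x ∈ K →
      ENNReal.ofReal (Real.exp (-(n * s))) ≤ L (dynBall T n x r)} := by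
  set E : ℕ → Set M := fun N => {x ∈ K | ∀ n ≥ N, T^[n] x ∈ K →
      ENNReal.ofReal (Real.exp (-(n * s))) ≤ L (dynBall T n x r)}
  have hmono : Monotone E := fun N N' h x hx => ⟨hx.1, fun n hn => hx.2 n (h.trans hn)⟩
  have hae : ∀ᵐ x ∂μ, x ∈ K → x ∈ ⋃ N, E N := by
    have := ae_lt_of_essSup_lt hs
    rw [ae_restrict_iff' hK.isClosed.measurableSet] at this
    filter_upwards [this] with x hx hxK
    obtain ⟨N, hN⟩ := eventually_atTop.1 (eventually_le_measure_dynBall (hx hxK) hr)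
    exact mem_iUnion.2 ⟨N, hxK, hN⟩
  -- Continuity from below; measurability of the sets `E N` is not required.
  have hlim := tendsto_measure_iUnion_atTop (μ := μ) hmono
  exact (hlim.eventually_const_lt (hm.trans_le (measure_mono_ae hae))).exists

/-- The entropy of a finite partition is bounded by the local volume entropy, for a measure
preserving map and a locally finite volume. -/
theorem exists_eventually_dynEntropy_le {M : Type*} [EMetricSpace M] [MeasurableSpace M]
    [BorelSpace M] {T : M → M} (hT : Continuous T) (μ L : Measure M) [IsProbabilityMeasure μ]
    [μ.InnerRegular] [IsLocallyFiniteMeasure L] (hμ : MeasurePreserving T μ μ) {k : ℕ}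
    (P : FinMeasPartition M k) {s η : ℝ} (hs : localVolumeEntropy T μ L < s) (hη : 0 < η) :
    ∃ C : ℝ, ∀ᶠ n : ℕ in atTop, P.dynEntropy T μ n ≤ C + n * (s + 3 * η) := by
  classical
  obtain ⟨ε, t, δ, hε, hε1, hεk, ht, htk, hδ, hδ1, htδ⟩ := exists_entropy_parameters k hη
  -- The mass outside `K` is `ε * δ` at most because Markov's inequality divides it by `δ`.
  obtain ⟨Q, r, V, hr, hK, hQP, hμQ, hsep, hVo, hVL, hballV⟩ :=
    exists_separated_compact_subsets μ L P (ε := ENNReal.ofReal (ε * δ)) (by simp; positivity)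
  set K := ⋃ j, Q j
  have hKm : MeasurableSet K := hK.isClosed.measurableSet
  have hεδ : ENNReal.ofReal (ε * δ) ≤ ENNReal.ofReal ε :=
    ENNReal.ofReal_le_ofReal (mul_le_of_le_one_right hε.le hδ1)
  have hμK : ENNReal.ofReal (1 - ε) ≤ μ K := by
    have h1 : 1 ≤ μ K + ENNReal.ofReal ε := by
      rw [← prob_add_prob_compl (μ := μ) hKm]
      gcongr
      exact hμQ.trans hεδ
    rw [ENNReal.ofReal_sub _ hε.le, ENNReal.ofReal_one]
    exact tsub_le_iff_right.2 h1
  have hKs : localVolumeEntropyOn T μ L K < s := by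
    refine lt_of_le_of_lt ?_ hs
    refine le_iSup₂_of_le K hK (le_iSup_of_le (lt_of_lt_of_le ?_ hμK) le_rfl)
    exact ENNReal.ofReal_pos.2 (by linarith)
  obtain ⟨N, hN⟩ := exists_uniform_le_measure_dynBall hK hKs hr
    (m := ENNReal.ofReal (1 - 2 * ε))
    (((ENNReal.ofReal_lt_ofReal_iff (by linarith)).2 (by linarith)).trans_le hμK)
  set E := {x ∈ K | ∀ n ≥ N, T^[n] x ∈ K →
      ENNReal.ofReal (Real.exp (-(n * s))) ≤ L (dynBall T n x r)}
  -- The `+ 1` keeps the logarithm's argument positive if `V` has volume zero.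
  refine ⟨Real.log 2 + Real.log ((L V).toReal + 1), ?_⟩
  filter_upwards [eventually_ge_atTop N, eventually_gt_atTop 0] with n hnN hn0
  set A := {x ∈ E | T^[n] x ∈ K ∧
    ((Finset.univ.filter fun i : Fin n => T^[(i : ℕ)] x ∈ Kᶜ).card : ℝ) ≤ δ * n}
  have hcov : E ⊆ A ∪ (T^[n] ⁻¹' Kᶜ ∪
      {x | δ * n < ((Finset.univ.filter fun i : Fin n => T^[(i : ℕ)] x ∈ Kᶜ).card : ℝ)}) := by
    intro x hx
    by_cases h1 : T^[n] x ∈ K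
    · by_cases h2 : ((Finset.univ.filter fun i : Fin n => T^[(i : ℕ)] x ∈ Kᶜ).card : ℝ) ≤ δ * n
      · exact Or.inl ⟨hx, h1, h2⟩
      · exact Or.inr (Or.inr (not_le.1 h2))
    · exact Or.inr (Or.inl h1)
  have hret : μ (T^[n] ⁻¹' Kᶜ) ≤ ENNReal.ofReal ε := by
    rw [(hμ.iterate n).measure_preimage hKm.compl.nullMeasurableSet]
    exact hμQ.trans hεδ
  have hbad : μ {x | δ * n < ((Finset.univ.filter fun i : Fin n => T^[(i : ℕ)] x ∈ Kᶜ).card : ℝ)} ≤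
      μ Kᶜ / ENNReal.ofReal δ := by
    convert measure_visits_gt_le hμ hKm.compl n hn0 hδ
  have hbad' : μ Kᶜ / ENNReal.ofReal δ ≤ ENNReal.ofReal ε := by
    refine ENNReal.div_le_of_le_mul ?_
    rwa [← ENNReal.ofReal_mul hε.le]
  -- `E` already misses at most `2 * ε`; failing to return at time `n` and too many visits outside
  -- `K` cost `ε` each.
  have hA : ENNReal.ofReal (1 - 4 * ε) ≤ μ A := by
    have h1 : ENNReal.ofReal (1 - 2 * ε) ≤ μ A + (ENNReal.ofReal ε + ENNReal.ofReal ε) :=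
      calc _ ≤ μ E := hN.le
        _ ≤ _ := (measure_mono hcov).trans (measure_union_le _ _)
        _ ≤ _ := by
          gcongr
          exact (measure_union_le _ _).trans (add_le_add hret (hbad.trans hbad'))
    rw [← ENNReal.ofReal_add hε.le hε.le] at h1
    have h2 : (1 - 4 * ε) = 1 - 2 * ε - (ε + ε) := by ring
    rw [h2, ENNReal.ofReal_sub _ (by linarith)]
    exact tsub_le_iff_right.2 h1
  obtain ⟨hne, hH⟩ := dynEntropy_le_log_card_itineraries P hT.measurable μ n hε1 hA
  have hcount := card_itineraries_mul_le hT L P Q hQP hsep ht hVo.measurableSet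
    (n := n) (δ := δ) (A := A) (c := ENNReal.ofReal (Real.exp (-(n * s))))
    (fun x hx => hx.1.2 n hnN hx.2.1)
    (fun x hx y hy => hballV x hx.1.1 (by simpa [edist_comm] using hy 0 hn0))
    (fun x hx => hx.2.2)
  set I := Finset.univ.filter fun a => (A ∩ P.dynCell T n a).Nonempty
  have hcard : 0 < (I.card : ℝ) := Nat.cast_pos.2 hne.card_pos
  have hreal := ENNReal.toReal_mono (ENNReal.mul_ne_top ENNReal.ofReal_ne_top hVL.ne) hcount
  rw [ENNReal.toReal_mul, ENNReal.toReal_mul, ENNReal.toReal_natCast,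
    ENNReal.toReal_ofReal (Real.exp_pos _).le, ENNReal.toReal_ofReal (Real.exp_pos _).le] at hreal
  have hv : 0 ≤ (L V).toReal := ENNReal.toReal_nonneg
  have hlog := Real.log_le_log (by positivity) (hreal.trans
    (mul_le_mul_of_nonneg_left (le_add_of_nonneg_right zero_le_one) (Real.exp_pos _).le))
  rw [Real.log_mul hcard.ne' (Real.exp_pos _).ne', Real.log_exp,
    Real.log_mul (Real.exp_pos _).ne' (by positivity), Real.log_exp] at hlog
  have h1 := mul_le_mul_of_nonneg_left (add_le_add (add_le_add htδ htk) hεk)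
    (Nat.cast_nonneg n : (0 : ℝ) ≤ n)
  linarith

theorem measureEntropy_le_localVolumeEntropy {M : Type*} [EMetricSpace M] [MeasurableSpace M]
    [BorelSpace M] {T : M → M} (hT : Continuous T) (μ L : Measure M) [IsProbabilityMeasure μ]
    [μ.InnerRegular] [IsLocallyFiniteMeasure L] (hμ : MeasurePreserving T μ μ) :
    measureEntropy T μ ≤ localVolumeEntropy T μ L := by
  refine iSup₂_le fun k P => EReal.le_of_forall_lt_iff_le.1 fun c hc => ?_
  obtain ⟨s, hs, hsc⟩ := EReal.lt_iff_exists_real_btwn.1 hc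
  have hsc' : s < c := EReal.coe_lt_coe_iff.1 hsc
  -- With `η = (c - s) / 4`, three parts are the error `3 * η` and the fourth absorbs `C / n`.
  obtain ⟨C, hC⟩ := exists_eventually_dynEntropy_le hT μ L hμ P hs
    (η := (c - s) / 4) (by linarith)
  refine limsup_le_of_le (by isBoundedDefault) ?_
  obtain ⟨N, hN⟩ := exists_nat_gt (C / ((c - s) / 4))
  filter_upwards [hC, eventually_ge_atTop N, eventually_gt_atTop 0] with n hn hnN hn0
  have hn' : (0 : ℝ) < n := Nat.cast_pos.2 hn0
  rw [EReal.coe_le_coe_iff, div_le_iff₀ hn']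
  have h1 : C / ((c - s) / 4) < n := hN.trans_le (Nat.cast_le.2 hnN)
  rw [div_lt_iff₀ (by linarith)] at h1
  linarith

theorem theorem1p4 {d : ℕ} {M : Type*} [EMetricSpace M] [CompleteSpace M]
    [SecondCountableTopology M]
    [ChartedSpace (EuclideanSpace ℝ (Fin d)) M] [IsManifold (𝓡 d) ∞ M]
    [RiemannianBundle (fun p : M => TangentSpace (𝓡 d) p)]
    [IsContMDiffRiemannianBundle (𝓡 d) ∞ (EuclideanSpace ℝ (Fin d))
      (fun p : M => TangentSpace (𝓡 d) p)]
    [IsRiemannianManifold (𝓡 d) M]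
    [MeasurableSpace M] [BorelSpace M]
    (T : M → M) (hT : Continuous T)
    (μ : Measure M) [IsProbabilityMeasure μ] (hμ : Ergodic T μ) :
    measureEntropy T μ ≤ localVolumeEntropy T μ (riemannianVolume d M) := by
  have : IsManifold (𝓡 d) 1 M := IsManifold.of_le (n := ∞) (by norm_cast)
  have : IsContinuousRiemannianBundle (EuclideanSpace ℝ (Fin d))
      (fun p : M => TangentSpace (𝓡 d) p) := by
    obtain ⟨g, hg, hinner⟩ := IsContMDiffRiemannianBundle.exists_contMDiff (IB := 𝓡 d) (n := ∞)
      (F := EuclideanSpace ℝ (Fin d)) (E := fun p : M => TangentSpace (𝓡 d) p)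
    exact ⟨g, hg.continuous, hinner⟩
  have := isLocallyFiniteMeasure_riemannianVolume (d := d) (M := M)
  -- Inner regularity of `μ` by compact sets is left to instance search: it holds for finite Borel
  -- measures on complete second countable metric spaces.
  exact measureEntropy_le_localVolumeEntropy hT μ _ hμ.toMeasurePreserving
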